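/- Let $\mathbb{D}=\{z\in\mathbb{C}:|z|<1\}$, and let $T_w(z)=\dfrac{z+w}{1+z\overline{w}}$ for $w\in\mathbb{D}$, $z\in\overline{\mathbb{D}}$. Let $g:[0,1]\to\mathbb{R}$ be continuous with $g(0)=0$ and $g(1)>0$, and let $\nu:\overline{\mathbb{D}}\to\mathbb{C}$ be the radial vector field $\nu(re^{i\theta})=g(r)e^{i\theta}$ (so $\nu(0)=0$). Let $\Omega\subset\mathbb{C}$ be a simply connected domain, let $f$ be a nonnegative integrable real-valued function on $\Omega$ with $\int_\Omega f\,dA>0$, where $dA$ is Lebesgue area measure, and let $F:\Omega\to\mathbb{D}$ be continuous. Then the function $z\mapsto\nu(T_w(F(z)))\,f(z)$ is integrable on $\Omega$ for each $w\in\mathbb{D}$, and there exists a point $w\in\mathbb{D}$ such that $$\int_\Omega \nu\big(T_w(F(z))\big)\,f(z)\,dA(z)=0 .$$ If in addition either (i) $g$ is strictly increasing on $[0,1]$, or (ii) $F$ is a (real) $C^1$-diffeomorphism of $\Omega$ onto $\mathbb{D}$ and $g$ is (not necessarily strictly) increasing on $[0,1]$ with $g(r)>0$ for all $0<r<1$,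 then the point $w\in\mathbb{D}$ is unique. -/

import Mathlib

open MeasureTheory Set

/-- The Möbius self-map `T_w(z) = (z + w) / (1 + z * conj w)` of the closed unit disk,
for `w` in the open unit disk. -/
noncomputable def diskMobius (w z : ℂ) : ℂ :=
  (z + w) / (1 + z * (starRingEnd ℂ) w)

/-- The radial vector field of magnitude `g`: `ν(r e^{iθ}) = g(r) e^{iθ}`.
At the origin its value is `0`. -/
noncomputable def radialField (g : ℝ → ℝ) (z : ℂ) : ℂ :=
  (g ‖z‖ : ℂ) * (z / (‖z‖ : ℂ))

/-- `F` restricts to a (real) `C¹` diffeomorphism from the open set `U` onto the open set `V`: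
it is `C¹` on `U`, and has a two-sided inverse `V → U` that is `C¹` on `V`. -/
def IsC1DiffeoOn (F : ℂ → ℂ) (U V : Set ℂ) : Prop :=
  ContDiffOn ℝ 1 F U ∧ MapsTo F U V ∧
    ∃ G : ℂ → ℂ, ContDiffOn ℝ 1 G V ∧ MapsTo G V U ∧
      LeftInvOn G F U ∧ RightInvOn G F V

/-!
Write `V(w) = ∫_Ω ν(T_w(F(z))) f(z) dA(z)`; the zeros of `V` in the disk are sought.

Existence. Since `F` takes values in the open disk, the formula for `T_w(F(z))` still makes sense
when `|w| = 1`, where it gives the constant `w` (`diskMobius_of_norm_eq_one`). By dominated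
convergence `V` is continuous on the closed disk, and `V(w) = g(1) (∫ f) w` on the unit circle. Such
a map has winding number one on the circle, so it vanishes inside
(`exists_eq_zero_of_eq_mul_on_circle`).

Uniqueness. If `v ≠ w`, then up to rotations `T_w` is `T_v` followed by a translation `T_s` along
the real axis, `0 < s < 1` (`exists_diskMobius_eq_mul_diskMobius`), and `ν` commutes with
rotations. On the right half-disk `T_s` increases both the modulus and the cosine of the argument;
on the part of the left half-disk that stays there it decreases the modulus and increases the
cosine; where it crosses from left to right, `Re ν` changes sign from negative to
positive. So `T_s` strictly increases `Re ν`, with the possible exception of points on the real axis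
when `g` is not strictly increasing (`radialField_re_lt_radialField_diskMobius_re`). If `F` is a
diffeomorphism, the exceptional points form a null set (`ae_im_mul_diskMobius_ne_zero`). If both
`V(v)` and `V(w)` vanished, the integral of `f` against an almost everywhere positive function
would vanish, contradicting `∫ f > 0`.
-/

/-! ### The Möbius maps -/

theorem one_add_mul_conj_ne_zero {z w : ℂ} (hz : ‖z‖ < 1) (hw : ‖w‖ ≤ 1) :
    1 + z * (starRingEnd ℂ) w ≠ 0 := by
  intro h
  have h1 : z * (starRingEnd ℂ) w = -1 := by linear_combination h
  have h2 : ‖z‖ * ‖w‖ = 1 := by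
    simpa using congrArg norm h1
  nlinarith [norm_nonneg z, norm_nonneg w]

theorem norm_sq_one_add_mul_conj_sub (z w : ℂ) :
    ‖1 + z * (starRingEnd ℂ) w‖ ^ 2 - ‖z + w‖ ^ 2 = (1 - ‖z‖ ^ 2) * (1 - ‖w‖ ^ 2) := by
  simp only [Complex.sq_norm, Complex.normSq_apply, Complex.add_re, Complex.add_im,
    Complex.mul_re, Complex.mul_im, Complex.one_re, Complex.one_im, Complex.conj_re,
    Complex.conj_im]
  ring

theorem norm_diskMobius_le_one {z w : ℂ} (hz : ‖z‖ < 1) (hw : ‖w‖ ≤ 1) :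
    ‖diskMobius w z‖ ≤ 1 := by
  have hpos : 0 < ‖1 + z * (starRingEnd ℂ) w‖ :=
    norm_pos_iff.2 (one_add_mul_conj_ne_zero hz hw)
  rw [diskMobius, norm_div, div_le_one hpos]
  have h := norm_sq_one_add_mul_conj_sub z w
  have h2 : 0 ≤ (1 - ‖z‖ ^ 2) * (1 - ‖w‖ ^ 2) :=
    mul_nonneg (by nlinarith [norm_nonneg z]) (by nlinarith [norm_nonneg w])
  exact le_of_sq_le_sq (by linarith) hpos.le

theorem norm_diskMobius_lt_one {z w : ℂ} (hz : ‖z‖ < 1) (hw : ‖w‖ < 1) :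
    ‖diskMobius w z‖ < 1 := by
  have hpos : 0 < ‖1 + z * (starRingEnd ℂ) w‖ :=
    norm_pos_iff.2 (one_add_mul_conj_ne_zero hz hw.le)
  rw [diskMobius, norm_div, div_lt_one hpos]
  have h := norm_sq_one_add_mul_conj_sub z w
  have h2 : 0 < (1 - ‖z‖ ^ 2) * (1 - ‖w‖ ^ 2) :=
    mul_pos (by nlinarith [norm_nonneg z]) (by nlinarith [norm_nonneg w])
  exact lt_of_pow_lt_pow_left₀ 2 hpos.le (by linarith)

/-- For a parameter `w` on the unit circle, the formula for `T_w` degenerates to the constant map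
with value `w`. -/
theorem diskMobius_of_norm_eq_one {z w : ℂ} (hz : ‖z‖ < 1) (hw : ‖w‖ = 1) :
    diskMobius w z = w := by
  rw [diskMobius, div_eq_iff (one_add_mul_conj_ne_zero hz hw.le)]
  have h : w * (starRingEnd ℂ) w = 1 := by
    rw [Complex.mul_conj, Complex.normSq_eq_norm_sq, hw]; simp
  linear_combination (-z) * h

theorem diskMobius_neg_diskMobius {z w : ℂ} (hz : ‖z‖ < 1) (hw : ‖w‖ < 1) :
    diskMobius (-w) (diskMobius w z) = z := by
  have h1 := one_add_mul_conj_ne_zero hz hw.le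
  have h2 := one_add_mul_conj_ne_zero (norm_diskMobius_lt_one hz hw)
    (w := -w) (by simpa using hw.le)
  rw [diskMobius, div_eq_iff h2]
  simp only [diskMobius, map_neg]
  field_simp
  ring

theorem diskMobius_neg_neg (w z : ℂ) : diskMobius (-w) (-z) = -diskMobius w z := by
  simp only [diskMobius, map_neg, neg_mul_neg]
  ring

/-- Two Möbius maps `T_v`, `T_w` with distinct parameters differ, up to rotations, by a
translation `T_s` along the real axis with `0 < s < 1`. -/
theorem exists_diskMobius_eq_mul_diskMobius {v w : ℂ} (hv : ‖v‖ < 1) (hw : ‖w‖ < 1)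
    (hvw : v ≠ w) :
    ∃ (s : ℝ) (e u : ℂ), 0 < s ∧ s < 1 ∧ ‖e‖ = 1 ∧ ‖u‖ = 1 ∧
      ∀ p : ℂ, ‖p‖ < 1 → diskMobius w p = u * diskMobius s (e * diskMobius v p) := by
  -- `T_w ∘ T_v⁻¹` is a rotation after `T_a`, where `a = (w - v) / (1 - w * conj v)`.
  obtain ⟨a, ha_def⟩ : ∃ a, a = diskMobius (-v) w := ⟨_, rfl⟩
  have hD : 1 - w * (starRingEnd ℂ) v ≠ 0 := by
    have h := one_add_mul_conj_ne_zero hw (w := -v) (by simpa using hv.le)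
    simpa [sub_eq_add_neg] using h
  have hD' : 1 - (starRingEnd ℂ) w * v ≠ 0 := by
    have h := (map_ne_zero (starRingEnd ℂ)).2 hD
    simpa using h
  have ha : a = (w - v) / (1 - w * (starRingEnd ℂ) v) := by
    rw [ha_def, diskMobius, map_neg]; ring_nf
  have ha0 : a ≠ 0 := by
    rw [ha]; exact div_ne_zero (sub_ne_zero.2 hvw.symm) hD
  have ha1 : ‖a‖ < 1 := by
    rw [ha_def]; exact norm_diskMobius_lt_one hw (by simpa using hv)
  have hac : (starRingEnd ℂ) a =
      ((starRingEnd ℂ) w - (starRingEnd ℂ) v) / (1 - (starRingEnd ℂ) w * v) := by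
    rw [ha]; simp
  have hs : (0 : ℝ) < ‖a‖ := norm_pos_iff.2 ha0
  have hsC : (‖a‖ : ℂ) ≠ 0 := by exact_mod_cast hs.ne'
  have he : ‖a / ‖a‖‖ = 1 := by simp [ha0]
  have hee : (a / ‖a‖) * (starRingEnd ℂ) (a / ‖a‖) = 1 := by
    rw [Complex.mul_conj, Complex.normSq_eq_norm_sq, he]; simp
  obtain ⟨e, he_def⟩ : ∃ e, e = a / ‖a‖ := ⟨_, rfl⟩
  rw [← he_def] at he hee
  have hae : a = ‖a‖ * e := by rw [he_def]; field_simp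
  refine ⟨‖a‖, (starRingEnd ℂ) e,
    (1 - w * (starRingEnd ℂ) v) / (1 - (starRingEnd ℂ) w * v) * e, hs, ha1, by simpa using he,
    ?_, ?_⟩
  · have : ‖1 - (starRingEnd ℂ) w * v‖ = ‖1 - w * (starRingEnd ℂ) v‖ := by
      rw [← Complex.norm_conj]; simp
    rw [norm_mul, norm_div, he, this, mul_one, div_self (norm_ne_zero_iff.2 hD)]
  · intro p hp
    have hrot : ∀ ζ : ℂ, e * diskMobius (‖a‖ : ℂ) ((starRingEnd ℂ) e * ζ) = diskMobius a ζ := by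
      intro ζ
      have h1 : (starRingEnd ℂ) a = ‖a‖ * (starRingEnd ℂ) e := by
        conv_lhs => rw [hae]
        simp
      simp only [diskMobius]
      rw [h1, Complex.conj_ofReal, ← mul_div_assoc, mul_add, ← mul_assoc, hee, one_mul,
        mul_comm e, ← hae]
      ring_nf
    rw [mul_assoc, hrot]
    have h1 := one_add_mul_conj_ne_zero hp hv.le
    have h2 := one_add_mul_conj_ne_zero hp hw.le
    have h3 := one_add_mul_conj_ne_zero (norm_diskMobius_lt_one hp hv) ha1.le
    have h4 : diskMobius w p * (1 + diskMobius v p * (starRingEnd ℂ) a) =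
        (1 - w * (starRingEnd ℂ) v) / (1 - (starRingEnd ℂ) w * v) * (diskMobius v p + a) := by
      rw [hac, ha]
      simp only [diskMobius]
      field_simp
      ring
    conv_rhs => rw [diskMobius]
    rw [← mul_div_assoc, eq_div_iff h3, h4]

theorem continuousOn_diskMobius {w : ℂ} (hw : ‖w‖ ≤ 1) :
    ContinuousOn (diskMobius w) (Metric.ball 0 1) := by
  unfold diskMobius
  refine ContinuousOn.div (by fun_prop) (by fun_prop) fun z hz => ?_
  exact one_add_mul_conj_ne_zero (by simpa using hz) hw

theorem continuousOn_diskMobius_parameter {z : ℂ} (hz : ‖z‖ < 1) :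
    ContinuousOn (fun w => diskMobius w z) (Metric.closedBall 0 1) := by
  unfold diskMobius
  refine ContinuousOn.div (by fun_prop)
    (continuous_const.add (continuous_const.mul Complex.continuous_conj)).continuousOn
    fun w hw => ?_
  exact one_add_mul_conj_ne_zero hz (by simpa using hw)

theorem differentiableOn_diskMobius {w : ℂ} (hw : ‖w‖ ≤ 1) :
    DifferentiableOn ℝ (diskMobius w) (Metric.ball 0 1) := by
  have : DifferentiableOn ℂ (diskMobius w) (Metric.ball 0 1) := by
    unfold diskMobius
    refine DifferentiableOn.div (by fun_prop) (by fun_prop) fun z hz => ?_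
    exact one_add_mul_conj_ne_zero (by simpa using hz) hw
  exact this.restrictScalars ℝ

/-! ### The radial field -/

theorem norm_radialField_le (g : ℝ → ℝ) (z : ℂ) : ‖radialField g z‖ ≤ |g ‖z‖| := by
  rw [radialField, norm_mul, norm_div, Complex.norm_real, Complex.norm_real, norm_norm,
    Real.norm_eq_abs]
  exact mul_le_of_le_one_right (abs_nonneg _) (div_self_le_one _)

theorem radialField_mul {u : ℂ} (hu : ‖u‖ = 1) (g : ℝ → ℝ) (z : ℂ) :
    radialField g (u * z) = u * radialField g z := by
  simp only [radialField, norm_mul, hu, one_mul]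
  ring

theorem radialField_neg (g : ℝ → ℝ) (z : ℂ) : radialField g (-z) = -radialField g z := by
  simp only [radialField, norm_neg]
  ring

theorem radialField_re (g : ℝ → ℝ) (z : ℂ) :
    (radialField g z).re = g ‖z‖ * (z.re / ‖z‖) := by
  rw [radialField, Complex.re_ofReal_mul, Complex.div_ofReal_re]

theorem continuousOn_radialField {g : ℝ → ℝ} (hg : ContinuousOn g (Icc 0 1)) (hg0 : g 0 = 0) :
    ContinuousOn (radialField g) (Metric.closedBall 0 1) := by
  have hn : ContinuousOn (fun z : ℂ => g ‖z‖) (Metric.closedBall 0 1) :=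
    hg.comp continuous_norm.continuousOn fun z hz => ⟨norm_nonneg z, by simpa using hz⟩
  intro z hz
  by_cases h0 : z = 0
  · -- At the origin `z / ‖z‖` is discontinuous, but bounded, while `g ‖z‖` tends to `0`.
    subst h0
    have h1 := (hn 0 hz).abs
    have hval : radialField g 0 = 0 := by simp [radialField]
    unfold ContinuousWithinAt at h1 ⊢
    rw [hval]
    refine squeeze_zero_norm (norm_radialField_le g) ?_
    simpa [hg0] using h1
  · have h1 := hn z hz
    have hz' : (‖z‖ : ℂ) ≠ 0 := by simpa using h0
    unfold radialField
    refine ContinuousWithinAt.mul ?_ ?_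
    · exact Complex.continuous_ofReal.continuousAt.comp_continuousWithinAt h1
    · exact ContinuousWithinAt.div continuousWithinAt_id (by fun_prop) hz'

theorem exists_norm_radialField_le {g : ℝ → ℝ} (hg : ContinuousOn g (Icc 0 1)) :
    ∃ M : ℝ, ∀ z : ℂ, ‖z‖ ≤ 1 → ‖radialField g z‖ ≤ M := by
  obtain ⟨M, hM⟩ := isCompact_Icc.exists_bound_of_continuousOn hg
  exact ⟨M, fun z hz => (norm_radialField_le g z).trans (hM ‖z‖ ⟨norm_nonneg z, hz⟩)⟩

/-! ### Monotonicity under translation along the real axis -/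

theorem re_div_norm_le_re_div_norm {z w : ℂ} (hz : 0 ≤ z.re) (hw : 0 < w.re)
    (h : z.re * |w.im| ≤ w.re * |z.im|) : z.re / ‖z‖ ≤ w.re / ‖w‖ := by
  have hwn : 0 < ‖w‖ := norm_pos_iff.2 fun h0 => by simp [h0] at hw
  rcases eq_or_ne z 0 with rfl | hz0
  · simp only [Complex.zero_re, zero_div]; positivity
  rw [div_le_div_iff₀ (norm_pos_iff.2 hz0) hwn]
  refine le_of_sq_le_sq ?_ (by positivity)
  have h2 := pow_le_pow_left₀ (by positivity) h 2
  rw [mul_pow, mul_pow, sq_abs, sq_abs] at h2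
  rw [mul_pow, mul_pow, Complex.sq_norm, Complex.sq_norm, Complex.normSq_apply,
    Complex.normSq_apply]
  linarith

theorem re_div_norm_lt_re_div_norm {z w : ℂ} (hz : 0 ≤ z.re) (hw : 0 < w.re)
    (h : z.re * |w.im| < w.re * |z.im|) : z.re / ‖z‖ < w.re / ‖w‖ := by
  have hwn : 0 < ‖w‖ := norm_pos_iff.2 fun h0 => by simp [h0] at hw
  have hz0 : z ≠ 0 := by rintro rfl; simp at h
  rw [div_lt_div_iff₀ (norm_pos_iff.2 hz0) hwn]
  refine lt_of_pow_lt_pow_left₀ 2 (by positivity) ?_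
  have h2 := pow_lt_pow_left₀ h (by positivity) two_ne_zero
  rw [mul_pow, mul_pow, sq_abs, sq_abs] at h2
  rw [mul_pow, mul_pow, Complex.sq_norm, Complex.sq_norm, Complex.normSq_apply,
    Complex.normSq_apply]
  linarith

theorem diskMobius_ofReal_re (s : ℝ) (z : ℂ) :
    (diskMobius s z).re =
      (z.re * (1 + s ^ 2) + s * (1 + ‖z‖ ^ 2)) / Complex.normSq (1 + z * s) := by
  rw [diskMobius, Complex.conj_ofReal, Complex.div_re, ← add_div, Complex.sq_norm,
    Complex.normSq_apply z]
  simp only [Complex.add_re, Complex.add_im, Complex.mul_re, Complex.mul_im, Complex.one_re,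
    Complex.one_im, Complex.ofReal_re, Complex.ofReal_im]
  ring_nf

theorem diskMobius_ofReal_im (s : ℝ) (z : ℂ) :
    (diskMobius s z).im = z.im * (1 - s ^ 2) / Complex.normSq (1 + z * s) := by
  rw [diskMobius, Complex.conj_ofReal, Complex.div_im, ← sub_div]
  simp only [Complex.add_re, Complex.add_im, Complex.mul_re, Complex.mul_im, Complex.one_re,
    Complex.one_im, Complex.ofReal_re, Complex.ofReal_im]
  ring_nf

theorem norm_lt_norm_diskMobius {s : ℝ} (hs0 : 0 < s) (hs1 : s < 1) {z : ℂ} (hz : ‖z‖ < 1)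
    (hre : 0 ≤ z.re) : ‖z‖ < ‖diskMobius s z‖ := by
  have hsn : ‖(s : ℂ)‖ = s := by simp [abs_of_pos hs0]
  have hpos : 0 < ‖1 + z * (starRingEnd ℂ) (s : ℂ)‖ :=
    norm_pos_iff.2 (one_add_mul_conj_ne_zero hz (by rw [hsn]; exact hs1.le))
  rw [diskMobius, norm_div, lt_div_iff₀ hpos]
  refine lt_of_pow_lt_pow_left₀ 2 (norm_nonneg _) ?_
  have h := norm_sq_one_add_mul_conj_sub z s
  rw [hsn] at h
  have h1 : 1 ≤ ‖1 + z * (starRingEnd ℂ) (s : ℂ)‖ ^ 2 := by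
    rw [Complex.conj_ofReal, Complex.sq_norm, Complex.normSq_apply]
    simp only [Complex.add_re, Complex.mul_re, Complex.one_re, Complex.ofReal_re,
      Complex.ofReal_im]
    nlinarith [mul_nonneg hre hs0.le, mul_self_nonneg (1 + z * (s : ℂ)).im]
  have h2 : 0 < 1 - ‖z‖ ^ 2 := by nlinarith [norm_nonneg z]
  rw [mul_pow]
  nlinarith [mul_pos h2 (pow_pos hs0 2), mul_le_mul_of_nonneg_left h1 h2.le]

/-- On the right half of the disk, `T_s` increases both the modulus and the cosine of the argument,
hence the real part of the radial field. -/
theorem radialField_re_lt_of_re_nonneg {g : ℝ → ℝ} (hg0 : g 0 = 0) (hg : MonotoneOn g (Icc 0 1))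
    (hgpos : ∀ r : ℝ, 0 < r → r < 1 → 0 < g r) {s : ℝ} (hs0 : 0 < s) (hs1 : s < 1) {z : ℂ}
    (hz : ‖z‖ < 1) (hstrict : StrictMonoOn g (Icc 0 1) ∨ z.im ≠ 0) (hre : 0 ≤ z.re) :
    (radialField g z).re < (radialField g (diskMobius s z)).re := by
  have hsn : ‖(s : ℂ)‖ < 1 := by simpa [abs_of_pos hs0] using hs1
  have hD : 0 < Complex.normSq (1 + z * s) := by
    have h := one_add_mul_conj_ne_zero hz hsn.le
    rw [Complex.conj_ofReal] at h
    exact Complex.normSq_pos.2 h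
  have hlt := norm_lt_norm_diskMobius hs0 hs1 hz hre
  have hlt1 := norm_diskMobius_lt_one hz hsn
  have hre' : 0 < (diskMobius s z).re := by
    rw [diskMobius_ofReal_re]; positivity
  have him' : |(diskMobius s z).im| = |z.im| * (1 - s ^ 2) / Complex.normSq (1 + z * s) := by
    rw [diskMobius_ofReal_im, abs_div, abs_mul, abs_of_pos hD,
      abs_of_pos (by nlinarith : 0 < 1 - s ^ 2)]
  have hkey : z.re * (1 - s ^ 2) < z.re * (1 + s ^ 2) + s * (1 + ‖z‖ ^ 2) := by
    have : 0 < s * (1 + ‖z‖ ^ 2) := by positivity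
    nlinarith [mul_nonneg hre (sq_nonneg s)]
  have hangle : z.re / ‖z‖ ≤ (diskMobius s z).re / ‖diskMobius s z‖ := by
    refine re_div_norm_le_re_div_norm hre hre' ?_
    rw [him', diskMobius_ofReal_re, ← mul_div_assoc, div_mul_eq_mul_div]
    gcongr ?_ / _
    nlinarith [mul_le_mul_of_nonneg_right hkey.le (abs_nonneg z.im)]
  have hc' : 0 < (diskMobius s z).re / ‖diskMobius s z‖ :=
    div_pos hre' ((norm_nonneg z).trans_lt hlt)
  have hmem : ‖z‖ ∈ Icc (0 : ℝ) 1 := ⟨norm_nonneg z, hz.le⟩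
  have hmem' : ‖diskMobius s z‖ ∈ Icc (0 : ℝ) 1 := ⟨norm_nonneg _, hlt1.le⟩
  have hgz : 0 ≤ g ‖z‖ := hg0 ▸ hg ⟨le_rfl, zero_le_one⟩ hmem (norm_nonneg z)
  rw [radialField_re, radialField_re]
  rcases hstrict with hsm | him
  · exact (mul_le_mul_of_nonneg_left hangle hgz).trans_lt
      (mul_lt_mul_of_pos_right (hsm hmem hmem' hlt) hc')
  · have hangle' : z.re / ‖z‖ < (diskMobius s z).re / ‖diskMobius s z‖ := by
      refine re_div_norm_lt_re_div_norm hre hre' ?_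
      rw [him', diskMobius_ofReal_re, ← mul_div_assoc, div_mul_eq_mul_div]
      gcongr ?_ / _
      nlinarith [mul_lt_mul_of_pos_right hkey (abs_pos.2 him)]
    have hz0 : 0 < ‖z‖ := norm_pos_iff.2 fun h => him (by simp [h])
    exact (mul_lt_mul_of_pos_left hangle' (hgpos _ hz0 hz)).trans_le
      (mul_le_mul_of_nonneg_right (hg hmem hmem' hlt.le) hc'.le)

/-- The translation `T_s` along the real axis strictly increases the real part of the radial
field, except possibly on the real axis if `g` is not strictly increasing. -/
theorem radialField_re_lt_radialField_diskMobius_re {g : ℝ → ℝ} (hg0 : g 0 = 0)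
    (hg : MonotoneOn g (Icc 0 1)) (hgpos : ∀ r : ℝ, 0 < r → r < 1 → 0 < g r)
    {s : ℝ} (hs0 : 0 < s) (hs1 : s < 1) {z : ℂ} (hz : ‖z‖ < 1)
    (hstrict : StrictMonoOn g (Icc 0 1) ∨ z.im ≠ 0) :
    (radialField g z).re < (radialField g (diskMobius s z)).re := by
  have hsn : ‖(s : ℂ)‖ < 1 := by simpa [abs_of_pos hs0] using hs1
  have hz' := norm_diskMobius_lt_one hz hsn
  rcases le_or_gt 0 z.re with hre | hre
  · exact radialField_re_lt_of_re_nonneg hg0 hg hgpos hs0 hs1 hz hstrict hre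
  rcases le_or_gt (diskMobius s z).re 0 with hre' | hre'
  · -- The reflection `z ↦ -z` conjugates `T_s` to its inverse and exchanges the two half-disks.
    have hback : diskMobius s (-diskMobius s z) = -z := by
      rw [← neg_neg (s : ℂ), diskMobius_neg_neg, neg_neg, diskMobius_neg_diskMobius hz hsn]
    have him : StrictMonoOn g (Icc 0 1) ∨ (-diskMobius s z).im ≠ 0 := by
      refine hstrict.imp_right fun h => ?_
      have hD : Complex.normSq (1 + z * s) ≠ 0 := by
        have h := one_add_mul_conj_ne_zero hz hsn.le
        rw [Complex.conj_ofReal] at h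
        exact (Complex.normSq_pos.2 h).ne'
      rw [Complex.neg_im, neg_ne_zero, diskMobius_ofReal_im]
      exact div_ne_zero (mul_ne_zero h (by nlinarith)) hD
    have h := radialField_re_lt_of_re_nonneg hg0 hg hgpos hs0 hs1 (z := -diskMobius s z)
      (by simpa using hz') him (by simpa using hre')
    rw [hback, radialField_neg, radialField_neg, Complex.neg_re, Complex.neg_re] at h
    linarith
  · have hzn : 0 < ‖z‖ := norm_pos_iff.2 fun h => by simp [h] at hre
    have hzn' : 0 < ‖diskMobius s z‖ := norm_pos_iff.2 fun h => by simp [h] at hre'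
    rw [radialField_re, radialField_re]
    exact (mul_neg_of_pos_of_neg (hgpos _ hzn hz) (div_neg_of_neg_of_pos hre hzn)).trans
      (mul_pos (hgpos _ hzn' hz') (div_pos hre' hzn'))

/-! ### Zeros of maps of the disk -/

/-- A continuous map on the closed disk that restricts to a nonzero multiple of the identity on
the unit circle vanishes inside the disk: otherwise it would have a continuous logarithm, which
would increase by `2πi` around the circle. -/
theorem exists_eq_zero_of_eq_mul_on_circle {V : ℂ → ℂ} {c : ℂ} (hc : c ≠ 0)
    (hV : ContinuousOn V (Metric.closedBall 0 1)) (hV1 : ∀ w : ℂ, ‖w‖ = 1 → V w = c * w) :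
    ∃ w ∈ Metric.ball (0 : ℂ) 1, V w = 0 := by
  by_contra! hne
  have hne' : ∀ w ∈ Metric.closedBall (0 : ℂ) 1, V w ≠ 0 := by
    intro w hw
    rcases (mem_closedBall_zero_iff.1 hw).lt_or_eq with h | h
    · exact hne w (mem_ball_zero_iff.2 h)
    · rw [hV1 w h]
      exact mul_ne_zero hc (norm_ne_zero_iff.1 (by rw [h]; exact one_ne_zero))
  -- Radial projection onto the closed disk extends `V` to the whole plane.
  let P : ℂ → ℂ := fun z => z / (max 1 ‖z‖ : ℝ)
  have hmax : ∀ z : ℂ, (0 : ℝ) < max 1 ‖z‖ := fun z => lt_max_of_lt_left one_pos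
  have hP : Continuous P := by
    refine continuous_id.div (Complex.continuous_ofReal.comp (by fun_prop)) fun z => ?_
    exact_mod_cast (hmax z).ne'
  have hPmem : ∀ z, P z ∈ Metric.closedBall (0 : ℂ) 1 := by
    intro z
    rw [mem_closedBall_zero_iff, norm_div, Complex.norm_real, Real.norm_eq_abs,
      abs_of_pos (hmax z), div_le_one (hmax z)]
    exact le_max_right _ _
  have hP1 : ∀ z : ℂ, ‖z‖ = 1 → P z = z := fun z hz => by simp [P, hz]
  have hsc : IsSimplyConnected (univ : Set ℂ) := by
    have : ContractibleSpace (univ : Set ℂ) :=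
      Convex.contractibleSpace (convex_univ (𝕜 := ℝ)) ⟨0, mem_univ _⟩
    exact SimplyConnectedSpace.ofContractible _
  obtain ⟨L, hLc, hL⟩ := Complex.exists_continuousOn_eqOn_exp_comp hsc isOpen_univ
    (g := fun z => V (P z)) (hV.comp hP.continuousOn fun z _ => hPmem z)
    (by rintro ⟨z, -, hz⟩; exact hne' _ (hPmem z) hz)
  have hLcont : Continuous L := continuousOn_univ.1 hLc
  -- `h t = L(exp(it)) - it` is a continuous logarithm of the constant `c`.
  let h : ℝ → ℂ := fun t => L (Complex.exp (t * Complex.I)) - t * Complex.I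
  have hcont : Continuous h := by fun_prop
  have hexp : ∀ t, Complex.exp (h t) = c := by
    intro t
    have h1 : Complex.exp (L (Complex.exp (t * Complex.I))) = c * Complex.exp (t * Complex.I) := by
      have := hL (mem_univ (Complex.exp (t * Complex.I)))
      simp only [Function.comp_apply] at this
      rw [this, hP1 _ (Complex.norm_exp_ofReal_mul_I t), hV1 _ (Complex.norm_exp_ofReal_mul_I t)]
    rw [Complex.exp_sub, h1, mul_div_assoc, div_self (Complex.exp_ne_zero _), mul_one]
  have hint : ∀ t, ∃ n : ℤ, (h t).im - (h 0).im = n * (2 * Real.pi) := by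
    intro t
    obtain ⟨n, hn⟩ := Complex.exp_eq_exp_iff_exists_int.1 ((hexp t).trans (hexp 0).symm)
    refine ⟨n, ?_⟩
    rw [hn]
    simp
  have hend : (h (2 * Real.pi)).im - (h 0).im = -(2 * Real.pi) := by
    simp [h, Complex.exp_two_pi_mul_I]
  have hpi := Real.pi_pos
  -- Being an integral multiple of `2π`, the increment of `h` cannot pass through `-π`.
  obtain ⟨t, -, ht⟩ := intermediate_value_Icc' (f := fun t => (h t).im - (h 0).im)
    (a := 0) (b := 2 * Real.pi) (by positivity)
    ((Complex.continuous_im.comp hcont).sub continuous_const).continuousOn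
    (show -Real.pi ∈ Icc _ _ by
      simp only [hend, sub_self]; constructor <;> linarith)
  obtain ⟨n, hn⟩ := hint t
  have h2 : ((2 * n + 1 : ℤ) : ℝ) * Real.pi = 0 := by
    push_cast
    simp only at ht
    linarith
  have h3 : (2 * n + 1 : ℤ) = 0 := by
    exact_mod_cast (mul_eq_zero.1 h2).resolve_right hpi.ne'
  omega

/-! ### The averaged field -/

section Averages

variable {Ω : Set ℂ} {f : ℂ → ℝ} {g : ℝ → ℝ}

theorem aestronglyMeasurable_radialField_comp (hΩ : IsOpen Ω) (hg : ContinuousOn g (Icc 0 1))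
    (hg0 : g 0 = 0) {H : ℂ → ℂ} (hH : ContinuousOn H Ω)
    (hH1 : MapsTo H Ω (Metric.closedBall 0 1)) :
    AEStronglyMeasurable (fun z => radialField g (H z)) (volume.restrict Ω) :=
  ((continuousOn_radialField hg hg0).comp hH hH1).aestronglyMeasurable hΩ.measurableSet

theorem integrableOn_radialField_comp_mul (hΩ : IsOpen Ω) (hf : IntegrableOn f Ω volume)
    (hg : ContinuousOn g (Icc 0 1)) (hg0 : g 0 = 0) {H : ℂ → ℂ} (hH : ContinuousOn H Ω)
    (hH1 : MapsTo H Ω (Metric.closedBall 0 1)) :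
    IntegrableOn (fun z => radialField g (H z) * (f z : ℂ)) Ω volume := by
  obtain ⟨M, hM⟩ := exists_norm_radialField_le hg
  refine Integrable.bdd_mul (c := M) hf.ofReal
    (aestronglyMeasurable_radialField_comp hΩ hg hg0 hH hH1) ?_
  filter_upwards [ae_restrict_mem hΩ.measurableSet] with z hz
  exact hM _ (by simpa using hH1 hz)

variable {F : ℂ → ℂ}

theorem continuousOn_integral_radialField_diskMobius (hΩ : IsOpen Ω)
    (hf : IntegrableOn f Ω volume) (hF : ContinuousOn F Ω) (hF1 : MapsTo F Ω (Metric.ball 0 1))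
    (hg : ContinuousOn g (Icc 0 1)) (hg0 : g 0 = 0) :
    ContinuousOn (fun w => ∫ z in Ω, radialField g (diskMobius w (F z)) * (f z : ℂ))
      (Metric.closedBall 0 1) := by
  obtain ⟨M, hM⟩ := exists_norm_radialField_le hg
  have hmaps : ∀ w ∈ Metric.closedBall (0 : ℂ) 1, ∀ z ∈ Ω, ‖diskMobius w (F z)‖ ≤ 1 :=
    fun w hw z hz => norm_diskMobius_le_one (by simpa using hF1 hz) (by simpa using hw)
  refine continuousOn_of_dominated (bound := fun z => M * ‖f z‖) ?_ ?_ (hf.norm.const_mul M) ?_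
  · intro w hw
    refine (integrableOn_radialField_comp_mul hΩ hf hg hg0
      ((continuousOn_diskMobius (by simpa using hw)).comp hF hF1) ?_).aestronglyMeasurable
    exact fun z hz => by simpa using hmaps w hw z hz
  · intro w hw
    filter_upwards [ae_restrict_mem hΩ.measurableSet] with z hz
    rw [norm_mul, Complex.norm_real]
    exact mul_le_mul_of_nonneg_right (hM _ (hmaps w hw z hz)) (norm_nonneg _)
  · filter_upwards [ae_restrict_mem hΩ.measurableSet] with z hz
    refine ContinuousOn.mul ?_ continuousOn_const
    exact (continuousOn_radialField hg hg0).comp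
      (continuousOn_diskMobius_parameter (by simpa using hF1 hz))
      fun w hw => by simpa using hmaps w hw z hz

theorem exists_integral_radialField_eq_zero (hΩ : IsOpen Ω)
    (hf : IntegrableOn f Ω volume) (hf_pos : 0 < ∫ z in Ω, f z)
    (hF : ContinuousOn F Ω) (hF1 : MapsTo F Ω (Metric.ball 0 1))
    (hg : ContinuousOn g (Icc 0 1)) (hg0 : g 0 = 0) (hg1 : 0 < g 1) :
    ∃ w ∈ Metric.ball (0 : ℂ) 1,
      ∫ z in Ω, radialField g (diskMobius w (F z)) * (f z : ℂ) = 0 := by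
  refine exists_eq_zero_of_eq_mul_on_circle (c := ((g 1 * ∫ z in Ω, f z : ℝ) : ℂ))
    (by exact_mod_cast (mul_pos hg1 hf_pos).ne')
    (continuousOn_integral_radialField_diskMobius hΩ hf hF hF1 hg hg0) ?_
  intro w hw
  have h1 : ∫ z in Ω, radialField g (diskMobius w (F z)) * (f z : ℂ) =
      ∫ z in Ω, (g 1 * w : ℂ) * (f z : ℂ) := by
    refine setIntegral_congr_fun hΩ.measurableSet fun z hz => ?_
    rw [diskMobius_of_norm_eq_one (by simpa using hF1 hz) hw, radialField, hw]
    simp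
  rw [h1, integral_const_mul, integral_complex_ofReal]
  push_cast
  ring

/-- Uniqueness under the assumption that, for almost every `z`, either `g` is strictly increasing
or `T_v (F z)` avoids the diameter in a given direction. -/
theorem eq_of_integral_radialField_eq_zero (hΩ : IsOpen Ω)
    (hf_nonneg : ∀ᵐ z ∂(volume.restrict Ω), 0 ≤ f z)
    (hf : IntegrableOn f Ω volume) (hf_pos : 0 < ∫ z in Ω, f z)
    (hF : ContinuousOn F Ω) (hF1 : MapsTo F Ω (Metric.ball 0 1))
    (hg : ContinuousOn g (Icc 0 1)) (hg0 : g 0 = 0)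
    (hgm : MonotoneOn g (Icc 0 1)) (hgpos : ∀ r : ℝ, 0 < r → r < 1 → 0 < g r)
    {v w : ℂ} (hv : ‖v‖ < 1) (hw : ‖w‖ < 1)
    (hstrict : ∀ e : ℂ, ‖e‖ = 1 → ∀ᵐ z ∂(volume.restrict Ω),
      StrictMonoOn g (Icc 0 1) ∨ (e * diskMobius v (F z)).im ≠ 0)
    (hv0 : ∫ z in Ω, radialField g (diskMobius v (F z)) * (f z : ℂ) = 0)
    (hw0 : ∫ z in Ω, radialField g (diskMobius w (F z)) * (f z : ℂ) = 0) : v = w := by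
  by_contra hvw
  obtain ⟨s, e, u, hs0, hs1, he, hu, h⟩ := exists_diskMobius_eq_mul_diskMobius hv hw hvw
  have hsn : ‖(s : ℂ)‖ < 1 := by simpa [abs_of_pos hs0] using hs1
  let η : ℂ → ℂ := fun z => e * diskMobius v (F z)
  have hη : ContinuousOn η Ω :=
    continuousOn_const.mul ((continuousOn_diskMobius hv.le).comp hF hF1)
  have hη1 : ∀ z ∈ Ω, ‖η z‖ < 1 := fun z hz => by
    rw [norm_mul, he, one_mul]
    exact norm_diskMobius_lt_one (by simpa using hF1 hz) hv
  have hiη := integrableOn_radialField_comp_mul hΩ hf hg hg0 hη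
    fun z hz => by simpa using (hη1 z hz).le
  have hiT := integrableOn_radialField_comp_mul hΩ hf hg hg0
    (H := fun z => diskMobius s (η z))
    ((continuousOn_diskMobius hsn.le).comp hη fun z hz => by simpa using hη1 z hz)
    fun z hz => by simpa using (norm_diskMobius_lt_one (hη1 z hz) hsn).le
  have hη0 : ∫ z in Ω, radialField g (η z) * (f z : ℂ) = 0 := by
    have h1 : ∀ z, radialField g (η z) * (f z : ℂ) =
        e * (radialField g (diskMobius v (F z)) * (f z : ℂ)) := fun z => by
      rw [radialField_mul he, mul_assoc]
    simp_rw [h1]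
    rw [integral_const_mul, hv0, mul_zero]
  have hT0 : ∫ z in Ω, radialField g (diskMobius s (η z)) * (f z : ℂ) = 0 := by
    have h1 : ∫ z in Ω, radialField g (diskMobius w (F z)) * (f z : ℂ) =
        ∫ z in Ω, u * (radialField g (diskMobius s (η z)) * (f z : ℂ)) := by
      refine setIntegral_congr_fun hΩ.measurableSet fun z hz => ?_
      rw [h _ (by simpa using hF1 hz), radialField_mul hu, mul_assoc]
    rw [h1, integral_const_mul] at hw0
    exact (mul_eq_zero.1 hw0).resolve_left fun h0 => by simp [h0] at hu
  -- The real part of the difference of the two integrands is a positive multiple of `f`.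
  let k : ℂ → ℝ := fun z =>
    ((radialField g (diskMobius s (η z))).re - (radialField g (η z)).re) * f z
  have hk : k = fun z => (radialField g (diskMobius s (η z)) * (f z : ℂ) -
      radialField g (η z) * (f z : ℂ)).re := by
    funext z
    simp only [k, Complex.sub_re, Complex.re_mul_ofReal, sub_mul]
  have hki : IntegrableOn k Ω volume := by
    rw [hk]; exact (hiT.sub hiη).re
  have hk0 : ∫ z in Ω, k z = 0 := by
    rw [hk]
    have h1 := Complex.reCLM.integral_comp_comm (hiT.sub hiη)
    simp only [Complex.reCLM_apply, Pi.sub_apply] at h1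
    rw [h1, integral_sub hiT hiη, hT0, hη0, sub_zero, Complex.zero_re]
  have hpos : ∀ᵐ z ∂(volume.restrict Ω),
      (radialField g (η z)).re < (radialField g (diskMobius s (η z))).re := by
    filter_upwards [ae_restrict_mem hΩ.measurableSet, hstrict e he] with z hz hz'
    exact radialField_re_lt_radialField_diskMobius_re hg0 hgm hgpos hs0 hs1 (hη1 z hz) hz'
  have hknn : 0 ≤ᵐ[volume.restrict Ω] k := by
    filter_upwards [hpos, hf_nonneg] with z h1 h2
    exact mul_nonneg (sub_nonneg.2 h1.le) h2
  have hkz := (integral_eq_zero_iff_of_nonneg_ae hknn hki).1 hk0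
  have hfz : f =ᵐ[volume.restrict Ω] 0 := by
    filter_upwards [hkz, hpos] with z h1 h2
    exact (mul_eq_zero.1 h1).resolve_left (sub_pos.2 h2).ne'
  exact hf_pos.ne' (integral_eq_zero_of_ae hfz)

/-- If `F` is a diffeomorphism onto the disk, almost no point is sent by `T_v ∘ F` to a given
diameter, since the `C¹` inverses of `F` and `T_v` preserve null sets. -/
theorem ae_im_mul_diskMobius_ne_zero (hΩ : IsOpen Ω)
    (hF : IsC1DiffeoOn F Ω (Metric.ball 0 1)) {v : ℂ} (hv : ‖v‖ < 1) {e : ℂ} (he : ‖e‖ = 1) :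
    ∀ᵐ z ∂(volume.restrict Ω), (e * diskMobius v (F z)).im ≠ 0 := by
  obtain ⟨-, hF1, G, hG, -, hGF, -⟩ := hF
  let S : Submodule ℝ ℂ := LinearMap.ker (Complex.imLm ∘ₗ LinearMap.mulLeft ℝ e)
  have hS : volume (S : Set ℂ) = 0 := by
    refine Measure.addHaar_submodule _ S fun htop => ?_
    have h1 : Complex.I * (starRingEnd ℂ) e ∈ S := htop ▸ Submodule.mem_top
    have h2 : e * (Complex.I * (starRingEnd ℂ) e) = Complex.I := by
      rw [mul_left_comm, Complex.mul_conj, Complex.normSq_eq_norm_sq, he]; simp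
    simp only [S, LinearMap.mem_ker, LinearMap.comp_apply, LinearMap.mulLeft_apply, h2] at h1
    simp at h1
  have hmapsT : MapsTo (diskMobius (-v)) (Metric.ball 0 1) (Metric.ball 0 1) := fun z hz => by
    simpa using norm_diskMobius_lt_one (w := -v) (by simpa using hz) (by simpa using hv)
  have hd : DifferentiableOn ℝ (G ∘ diskMobius (-v)) ((S : Set ℂ) ∩ Metric.ball 0 1) :=
    ((hG.differentiableOn one_ne_zero).comp
      (differentiableOn_diskMobius (by simpa using hv.le)) hmapsT).mono inter_subset_right
  have hnull := addHaar_image_eq_zero_of_differentiableOn_of_addHaar_eq_zero volume hd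
    (measure_mono_null inter_subset_left hS)
  rw [ae_restrict_iff' hΩ.measurableSet]
  refine measure_mono_null ?_ hnull
  intro z hz
  simp only [mem_compl_iff, mem_ofPred_eq, Classical.not_imp, not_not] at hz
  obtain ⟨hzΩ, hz0⟩ := hz
  have hFz : ‖F z‖ < 1 := by simpa using hF1 hzΩ
  refine ⟨diskMobius v (F z), ⟨?_, by simpa using norm_diskMobius_lt_one hFz hv⟩, ?_⟩
  · simpa [S] using hz0
  · rw [Function.comp_apply, diskMobius_neg_diskMobius hFz hv, hGF hzΩ]

end Averages

/-! ### Existence and uniqueness of the center of mass -/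

theorem mainTheorem9
    (Ω : Set ℂ) (hΩ_open : IsOpen Ω) (hΩ_sc : IsSimplyConnected Ω)
    (f : ℂ → ℝ) (hf_nonneg : ∀ᵐ z ∂(volume.restrict Ω), 0 ≤ f z)
    (hf_int : IntegrableOn f Ω volume) (hf_pos : 0 < ∫ z in Ω, f z)
    (F : ℂ → ℂ) (hF_cont : ContinuousOn F Ω) (hF_maps : MapsTo F Ω (Metric.ball 0 1))
    (g : ℝ → ℝ) (hg_cont : ContinuousOn g (Icc 0 1)) (hg_zero : g 0 = 0) (hg_one : 0 < g 1) :
    (∀ w ∈ Metric.ball (0 : ℂ) 1,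
      IntegrableOn (fun z => radialField g (diskMobius w (F z)) * (f z : ℂ)) Ω volume) ∧
    (∃ w ∈ Metric.ball (0 : ℂ) 1,
      ∫ z in Ω, radialField g (diskMobius w (F z)) * (f z : ℂ) = 0) ∧
    ((StrictMonoOn g (Icc 0 1) ∨
        (IsC1DiffeoOn F Ω (Metric.ball 0 1) ∧ MonotoneOn g (Icc 0 1) ∧
          ∀ r : ℝ, 0 < r → r < 1 → 0 < g r)) →
      ∃! w : ℂ, w ∈ Metric.ball (0 : ℂ) 1 ∧
        ∫ z in Ω, radialField g (diskMobius w (F z)) * (f z : ℂ) = 0) := by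
  have hex := exists_integral_radialField_eq_zero hΩ_open hf_int hf_pos hF_cont hF_maps
    hg_cont hg_zero hg_one
  refine ⟨fun w hw => ?_, hex, fun hcase => ?_⟩
  · have hw1 : ‖w‖ < 1 := by simpa using hw
    refine integrableOn_radialField_comp_mul hΩ_open hf_int hg_cont hg_zero
      ((continuousOn_diskMobius hw1.le).comp hF_cont hF_maps) fun z hz => ?_
    simpa using norm_diskMobius_le_one (by simpa using hF_maps hz) hw1.le
  · have hmono : MonotoneOn g (Icc 0 1) := hcase.elim (fun h => h.monotoneOn) fun h => h.2.1
    have hpos : ∀ r : ℝ, 0 < r → r < 1 → 0 < g r := hcase.elim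
      (fun h r hr0 hr1 => hg_zero ▸ h ⟨le_rfl, zero_le_one⟩ ⟨hr0.le, hr1.le⟩ hr0)
      fun h => h.2.2
    obtain ⟨w, hw, hw0⟩ := hex
    refine ⟨w, ⟨hw, hw0⟩, ?_⟩
    rintro v ⟨hv, hv0⟩
    have hv1 : ‖v‖ < 1 := by simpa using hv
    refine eq_of_integral_radialField_eq_zero hΩ_open hf_nonneg hf_int hf_pos hF_cont hF_maps
      hg_cont hg_zero hmono hpos hv1 (by simpa using hw) (fun e he => ?_) hv0 hw0
    rcases hcase with hs | ⟨hd, -, -⟩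
    · exact Filter.Eventually.of_forall fun _ => Or.inl hs
    · exact (ae_im_mul_diskMobius_ne_zero hΩ_open hd hv1 he).mono fun _ h => Or.inr h
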